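/- Let $a\in\mathbb R$, $b>0$ and $g\in L^2(\mathbb R)$. Write $E_{mb}T_{na}g(t)=e^{2\pi i mbt}g(t-na)$ for $m,n\in\mathbb Z$, and let $\langle f,h\rangle=\int_{\mathbb R} f\,\overline h\,dt$. Assume that $g\in\mathbf{PF}$, i.e. that the system $(E_{mb}T_{na}g)_{m,n\in\mathbb Z}$ has a finite upper frame bound: there is $B>0$ with $$\sum_{m,n\in\mathbb Z}|\langle f,E_{mb}T_{na}g\rangle|^2\le B\|f\|^2\quad\text{for all } f\in L^2(\mathbb R).$$ For $k\in\mathbb Z$ put $$G_k(t)=\sum_{n\in\mathbb Z}g(t-na)\,\overline{g(t-na-k/b)},$$ for $f\in L^2(\mathbb R)$ put $Sf=\sum_{m,n\in\mathbb Z}\langle f,E_{mb}T_{na}g\rangle E_{mb}T_{na}g$, and for $K,L\in\mathbb Z$ put $$S_{K,L}f(t)=\frac1b\sum_{k=-L}^{K}f(t-k/b)\,G_k(t).$$ Then each series $G_k(t)$ converges absolutely for almost every $t$, $S$ and all $S_{K,L}$ are well-defined bounded linear operators on $L^2(\mathbb R)$ (the series for $Sf$ converging unconditionally in norm), and the following are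 equivalent: (1) For every $f\in L^2(\mathbb R)$ the Walnut series converges in norm, i.e. $\lim_{K,L\to\infty}S_{K,L}f$ exists in the norm of $L^2(\mathbb R)$. (2) For every $f\in L^2(\mathbb R)$ the Walnut series converges weakly, i.e. $\lim_{K,L\to\infty}S_{K,L}f$ exists in the weak topology of $L^2(\mathbb R)$. (3) $\sup_{K,L\in\mathbb Z}\|S_{K,L}\|<\infty$. (4) For every $f\in L^2(\mathbb R)$, $\displaystyle\lim_{K,L\to\infty}\langle S_{K,L}f,f\rangle=\langle Sf,f\rangle$. (5) For every $f\in L^2(\mathbb R)$, $$\sum_{m,n\in\mathbb Z}|\langle f,E_{mb}T_{na}g\rangle|^2=\lim_{K,L\to\infty}\frac1b\sum_{k=-L}^{K}\int_{\mathbb R}\overline{f(t)}\,f(t-k/b)\,G_k(t)\,dt.$$ Here $\lim_{K,L\to\infty}$ means that $K$ and $L$ tend to infinity independently. -/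

import Mathlib

open MeasureTheory Filter Topology

/-- The complex Hilbert space `L²(ℝ)` with respect to Lebesgue measure. -/
abbrev L2R : Type := Lp ℂ 2 (volume : Measure ℝ)

/-- The function `E_{mb} T_{na} g : t ↦ e^{2πi m b t} g(t - n a)`. -/
noncomputable def whFun (g : ℝ → ℂ) (a b : ℝ) (m n : ℤ) (t : ℝ) : ℂ :=
  Complex.exp (2 * Real.pi * Complex.I * (m * b * t)) * g (t - n * a)

theorem memLp_whFun {g : ℝ → ℂ} (hg : MemLp g 2 (volume : Measure ℝ)) (a b : ℝ) (m n : ℤ) :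
    MemLp (whFun g a b m n) 2 (volume : Measure ℝ) := by
  have h1 : MemLp (fun t => g (t - n * a)) 2 (volume : Measure ℝ) :=
    hg.comp_measurePreserving (measurePreserving_sub_right volume (n * a))
  have hc : Continuous (fun t : ℝ => Complex.exp (2 * Real.pi * Complex.I * (m * b * t))) := by
    fun_prop
  refine h1.of_le (hc.aestronglyMeasurable.mul h1.1) (Eventually.of_forall fun t => ?_)
  have h2 : ‖Complex.exp (2 * Real.pi * Complex.I * (m * b * t))‖ = 1 := by
    have := Complex.norm_exp_ofReal_mul_I (2 * Real.pi * (m * b * t))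
    rw [← this]
    congr 2
    push_cast
    ring
  simp [whFun, h2]

/-- The member `E_{mb} T_{na} g` of the Weyl-Heisenberg system `(g, a, b)`, as an element of
`L²(ℝ)`. -/
noncomputable def whAtom (g : L2R) (a b : ℝ) (m n : ℤ) : L2R :=
  (memLp_whFun (Lp.memLp g) a b m n).toLp (whFun g a b m n)

/-- `g ∈ PF` (for the parameters `a, b`): the system `(E_{mb} T_{na} g)_{m,n ∈ ℤ}` has a finite
upper frame bound. Mathlib's inner product is linear in the second variable, so `⟨f, h⟩` in the
convention that is linear in the first variable is `inner ℂ h f`. -/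
def IsPreframe (g : L2R) (a b : ℝ) : Prop :=
  ∃ B : ℝ, 0 < B ∧ ∀ f : L2R,
    Summable (fun p : ℤ × ℤ => ‖inner ℂ (whAtom g a b p.1 p.2) f‖ ^ 2) ∧
    ∑' p : ℤ × ℤ, ‖inner ℂ (whAtom g a b p.1 p.2) f‖ ^ 2 ≤ B * ‖f‖ ^ 2

/-- `S` is the frame operator of `(g, a, b)`:
`S f = ∑_{m,n} ⟨f, E_{mb} T_{na} g⟩ E_{mb} T_{na} g` for all `f`, with convergence in `L²(ℝ)`. -/
def IsFrameOperator (g : L2R) (a b : ℝ) (S : L2R →L[ℂ] L2R) : Prop :=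
  ∀ f : L2R, HasSum
    (fun p : ℤ × ℤ => (inner ℂ (whAtom g a b p.1 p.2) f : ℂ) • whAtom g a b p.1 p.2) (S f)

/-- The `n`-th term `g(t - n a) * conj (g(t - n a - k/b))` of the series `G_k(t)`. -/
noncomputable def walnutTerm (g : L2R) (a b : ℝ) (k : ℤ) (t : ℝ) (n : ℤ) : ℂ :=
  g (t - n * a) * (starRingEnd ℂ) (g (t - n * a - k / b))

/-- `G_k(t) = ∑_n g(t - n a) * conj (g(t - n a - k/b))`. -/
noncomputable def walnutG (g : L2R) (a b : ℝ) (k : ℤ) (t : ℝ) : ℂ :=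
  ∑' n : ℤ, walnutTerm g a b k t n

/-- `T` is the operator `S_{K,L}` on `L²(ℝ)`, the partial sum of the Walnut representation:
`S_{K,L} f(t) = (1/b) ∑_{k=-L}^{K} f(t - k/b) G_k(t)` for almost every `t`. -/
def IsWalnutPartialSum (g : L2R) (a b : ℝ) (K L : ℤ) (T : L2R →L[ℂ] L2R) : Prop :=
  ∀ f : L2R, ∀ᵐ t : ℝ,
    T f t = (1 / b : ℂ) * ∑ k ∈ Finset.Icc (-L) K, f (t - k / b) * walnutG g a b k t

/-! Cut ℝ into blocks of length `1/b` with projections `P_j`. The modulations `e^{2πimbt}` form, up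
to scaling, an orthonormal basis on each block, so Parseval in `m`, followed by summation over `n`,
gives `P_{j+k} S P_j = D_k P_j` with `D_k f = (1/b) f(· - k/b) G_k`
(`blockProj_frameOperator_blockProj`). Thus `S_{K,L}` collects finitely many diagonals of the block
matrix of `S`. On a function living in one block the Walnut series is just the block expansion of `S
P_j f`, so it converges to `S P_j f`. Finite sums of such functions are dense, so uniform
boundedness of `S_{K,L}` yields strong convergence to `S` (`tendsto_sum_diagonals`). Conversely weak
convergence forces boundedness by Banach–Steinhaus, and quadratic forms control weak limits by
polarisation. That the `G_k` exist and are bounded comes from `IsPreframe.hasBoundedPeriodization`.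
-/

/-! ### Two-sided partial sums over ℤ. -/

theorem Int.sum_Icc_split {E : Type*} [AddCommGroup E] (z : ℤ → E) {x y w : ℤ} (hxy : x ≤ y + 1)
    (hyw : y ≤ w) :
    ∑ k ∈ Finset.Icc x w, z k = ∑ k ∈ Finset.Icc x y, z k + ∑ k ∈ Finset.Icc (y + 1) w, z k := by
  have h : Finset.Icc x w = Finset.Icc x y ∪ Finset.Icc (y + 1) w := by
    ext k; simp only [Finset.mem_union, Finset.mem_Icc]; omega
  rw [h, Finset.sum_union]
  exact Finset.disjoint_left.2 fun k => by simp only [Finset.mem_Icc]; omega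

/-- If the two-sided partial sums of a series indexed by `ℤ` converge, then all of them are
bounded by a common constant. -/
theorem exists_bound_sum_Icc_of_tendsto {E : Type*} [NormedAddCommGroup E] {z : ℤ → E} {l : E}
    (h : Tendsto (fun p : ℤ × ℤ => ∑ k ∈ Finset.Icc (-p.2) p.1, z k) atTop (𝓝 l)) :
    ∃ C, ∀ p : ℤ × ℤ, ‖∑ k ∈ Finset.Icc (-p.2) p.1, z k‖ ≤ C := by
  obtain ⟨⟨N₁, N₂⟩, hN⟩ := eventually_atTop.1 (h (Metric.closedBall_mem_nhds l one_pos))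
  set N : ℤ := max 0 (max N₁ N₂)
  have hN0 : 0 ≤ N := le_max_left _ _
  have h₁ : N₁ ≤ N := (le_max_left _ _).trans (le_max_right _ _)
  have h₂ : N₂ ≤ N := (le_max_right _ _).trans (le_max_right _ _)
  have hbig : ∀ K L : ℤ, N ≤ K → N ≤ L → ‖∑ k ∈ Finset.Icc (-L) K, z k‖ ≤ ‖l‖ + 1 := by
    intro K L hK hL
    have h3 := hN (K, L) ⟨h₁.trans hK, h₂.trans hL⟩
    rw [Metric.mem_closedBall, dist_eq_norm] at h3
    calc _ = ‖l + (∑ k ∈ Finset.Icc (-L) K, z k - l)‖ := by rw [add_sub_cancel]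
      _ ≤ ‖l‖ + 1 := (norm_add_le _ _).trans (by gcongr)
  set M : ℝ := ∑ k ∈ Finset.Icc (-N) N, ‖z k‖
  have hsmall : ∀ x y : ℤ, -N ≤ x → y ≤ N → ‖∑ k ∈ Finset.Icc x y, z k‖ ≤ M := fun x y hx hy =>
    (norm_sum_le _ _).trans
      (Finset.sum_le_sum_of_subset_of_nonneg (Finset.Icc_subset_Icc hx hy) fun _ _ _ =>
        norm_nonneg _)
  have hM0 : 0 ≤ M := Finset.sum_nonneg fun _ _ => norm_nonneg _
  set C := ‖l‖ + 1 + M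
  have hl := norm_nonneg l
  -- With the other endpoint fixed at `-N`, a one-sided sum is a large two-sided one minus a central
  -- piece bounded by `M`.
  have hright : ∀ y : ℤ, ‖∑ k ∈ Finset.Icc 0 y, z k‖ ≤ C := by
    intro y
    rcases le_total y N with hy | hy
    · exact (hsmall 0 y (by omega) hy).trans (by linarith)
    · have h3 := Int.sum_Icc_split z (x := -N) (y := -1) (w := y) (by omega) (by omega)
      rw [neg_add_cancel] at h3
      rw [eq_sub_of_add_eq' h3.symm]
      exact (norm_sub_le _ _).trans (add_le_add (hbig y N hy le_rfl) (hsmall _ _ le_rfl (by omega)))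
  have hleft : ∀ x : ℤ, ‖∑ k ∈ Finset.Icc x (-1), z k‖ ≤ C := by
    intro x
    rcases le_total (-N) x with hx | hx
    · exact (hsmall x (-1) hx (by omega)).trans (by linarith)
    · have h3 := Int.sum_Icc_split z (x := x) (y := -1) (w := N) (by omega) (by omega)
      rw [eq_sub_of_add_eq h3.symm]
      have h4 := hbig N (-x) le_rfl (by omega)
      rw [neg_neg] at h4
      exact (norm_sub_le _ _).trans (add_le_add h4 (hsmall _ _ (by omega) (by omega)))
  refine ⟨C + C, fun ⟨y, x'⟩ => ?_⟩
  obtain ⟨x, rfl⟩ : ∃ x, x' = -x := ⟨-x', by simp⟩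
  simp only [neg_neg]
  rcases lt_or_ge y x with hxy | hxy
  · rw [Finset.Icc_eq_empty (by omega)]; simp; positivity
  rcases lt_or_ge y 0 with hy | hy
  · have h3 := Int.sum_Icc_split z (x := x) (y := y) (w := -1) (by omega) (by omega)
    have h4 := hleft (y + 1)
    rw [eq_sub_of_add_eq h3.symm]
    exact (norm_sub_le _ _).trans (add_le_add (hleft x) h4)
  rcases le_or_gt x 0 with hx | hx
  · have h3 := Int.sum_Icc_split z (x := x) (y := -1) (w := y) (by omega) (by omega)
    rw [h3]
    exact (norm_add_le _ _).trans (add_le_add (hleft x) (hright y))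
  · have h3 := Int.sum_Icc_split z (x := 0) (y := x - 1) (w := y) (by omega) (by omega)
    rw [sub_add_cancel] at h3
    rw [eq_sub_of_add_eq' h3.symm]
    exact (norm_sub_le _ _).trans (add_le_add (hright y) (hright (x - 1)))

/-! ### Uniform boundedness and sums of diagonals. -/

/-- A weakly pointwise bounded family of operators on a Hilbert space is uniformly bounded. -/
theorem exists_norm_le_of_weakly_bounded {E ι : Type*} [NormedAddCommGroup E]
    [InnerProductSpace ℂ E] [CompleteSpace E] (T : ι → E →L[ℂ] E)
    (h : ∀ f φ : E, ∃ C, ∀ i, ‖(inner ℂ φ (T i f) : ℂ)‖ ≤ C) : ∃ C, ∀ i, ‖T i‖ ≤ C := by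
  refine banach_steinhaus fun f => ?_
  obtain ⟨C, hC⟩ := banach_steinhaus (g := fun i => innerSL ℂ (T i f)) fun φ => by
    obtain ⟨C, hC⟩ := h f φ
    exact ⟨C, fun i => by rw [innerSL_apply_apply, norm_inner_symm]; exact hC i⟩
  exact ⟨C, fun i => by simpa using hC i⟩

/-- A limit along `atTop` in `ℤ × ℤ` bounds only a tail, which omits infinitely many indices; the
partial-sum structure supplies the bound at all of them, as Banach–Steinhaus requires. -/
theorem bddAbove_norm_sum_Icc_of_weak_tendsto {E : Type*} [NormedAddCommGroup E]
    [InnerProductSpace ℂ E] [CompleteSpace E] (D : ℤ → E →L[ℂ] E)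
    (h : ∀ f : E, ∃ l : E, ∀ φ : E, Tendsto
      (fun p : ℤ × ℤ => (inner ℂ φ ((∑ k ∈ Finset.Icc (-p.2) p.1, D k) f) : ℂ)) atTop
      (𝓝 (inner ℂ φ l))) :
    BddAbove (Set.range fun p : ℤ × ℤ => ‖∑ k ∈ Finset.Icc (-p.2) p.1, D k‖) := by
  obtain ⟨C, hC⟩ := exists_norm_le_of_weakly_bounded
    (fun p : ℤ × ℤ => ∑ k ∈ Finset.Icc (-p.2) p.1, D k) fun f φ => by
      obtain ⟨l, hl⟩ := h f
      have h1 := hl φ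
      simp only [_root_.sum_apply, inner_sum] at h1 ⊢
      exact exists_bound_sum_Icc_of_tendsto h1
  exact ⟨C, by rintro _ ⟨p, rfl⟩; exact hC p⟩

theorem tendsto_Icc_neg_atTop :
    Tendsto (fun p : ℤ × ℤ => Finset.Icc (-p.2) p.1) atTop atTop := by
  refine tendsto_atTop_finset_of_monotone ?_ fun x => ⟨(x, -x), by simp⟩
  rintro ⟨K, L⟩ ⟨K', L'⟩ ⟨h₁, h₂⟩
  exact Finset.Icc_subset_Icc (neg_le_neg h₂) h₁

/-- If `S` is decomposed into diagonals `D k` by a resolution of the identity `P j`, and the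
two-sided partial sums of the diagonals are uniformly bounded, then they converge strongly
to `S`. -/
theorem tendsto_sum_diagonals {E : Type*} [NormedAddCommGroup E] [NormedSpace ℂ E]
    (P D : ℤ → E →L[ℂ] E) (S : E →L[ℂ] E) (hP : ∀ f, HasSum (fun j => P j f) f)
    (hD : ∀ j k f, P (j + k) (S (P j f)) = D k (P j f))
    (hbdd : BddAbove (Set.range fun p : ℤ × ℤ => ‖∑ k ∈ Finset.Icc (-p.2) p.1, D k‖)) (f : E) :
    Tendsto (fun p : ℤ × ℤ => (∑ k ∈ Finset.Icc (-p.2) p.1, D k) f) atTop (𝓝 (S f)) := by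
  obtain ⟨C, hC⟩ := hbdd
  replace hC : ∀ p : ℤ × ℤ, ‖∑ k ∈ Finset.Icc (-p.2) p.1, D k‖ ≤ C := fun p => hC ⟨p, rfl⟩
  have hC0 : 0 ≤ C := (norm_nonneg _).trans (hC 0)
  have hblock : ∀ j, Tendsto (fun p : ℤ × ℤ => (∑ k ∈ Finset.Icc (-p.2) p.1, D k) (P j f)) atTop
      (𝓝 (S (P j f))) := by
    intro j
    -- Reindexing by `k ↦ j + k` turns the block expansion of `S (P j f)` into the series of the `D
    -- k (P j f)`.
    have h1 := ((Equiv.addLeft j).hasSum_iff.2 (hP (S (P j f)))).comp tendsto_Icc_neg_atTop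
    simpa [Function.comp_def, hD, _root_.sum_apply] using h1
  rw [Metric.tendsto_nhds]
  intro ε hε
  -- The `+ 1` keeps the denominator positive when `C` and `‖S‖` vanish.
  have hδ : 0 < ε / (2 * (C + ‖S‖ + 1)) := by positivity
  obtain ⟨s, hs⟩ := ((Metric.tendsto_nhds.1 (hP f)) _ hδ).exists
  have h2 : Tendsto (fun p : ℤ × ℤ => (∑ k ∈ Finset.Icc (-p.2) p.1, D k) (∑ j ∈ s, P j f)) atTop
      (𝓝 (S (∑ j ∈ s, P j f))) := by
    simp only [map_sum]
    exact tendsto_finsetSum _ fun j _ => hblock j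
  filter_upwards [Metric.tendsto_nhds.1 h2 (ε / 2) (by positivity)] with p hp
  set T := ∑ k ∈ Finset.Icc (-p.2) p.1, D k
  set F := ∑ j ∈ s, P j f
  rw [dist_eq_norm] at hs hp ⊢
  have h3 : T f - S f = (T F - S F) - (T (F - f) - S (F - f)) := by simp only [map_sub]; abel
  have h4 : ‖T (F - f)‖ ≤ C * ‖F - f‖ := T.le_of_opNorm_le (hC p) _
  have h5 : ‖S (F - f)‖ ≤ ‖S‖ * ‖F - f‖ := S.le_opNorm _
  have h6 : (C + ‖S‖) * ‖F - f‖ ≤ ε / 2 := by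
    have hS := norm_nonneg S
    calc (C + ‖S‖) * ‖F - f‖ ≤ (C + ‖S‖ + 1) * (ε / (2 * (C + ‖S‖ + 1))) := by
          refine mul_le_mul (by linarith) hs.le (norm_nonneg _) (by positivity)
      _ = ε / 2 := by field_simp
  calc ‖T f - S f‖ ≤ ‖T F - S F‖ + (‖T (F - f)‖ + ‖S (F - f)‖) := by
        rw [h3]; exact (norm_sub_le _ _).trans (by gcongr; exact norm_sub_le _ _)
    _ < ε := by linarith

/-! ### Parseval on an interval of length `1/b`. -/

/-- Parseval's identity, in polarised form, for functions supported in an interval of length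
`1 / b`. -/
theorem hasSum_parseval_of_support {b : ℝ} (hb : 0 < b) (c : ℝ) {u v : ℝ → ℂ}
    (hu : MemLp u 2 volume) (hv : MemLp v 2 volume)
    (hus : ∀ t, t ∉ Set.Ioc c (c + 1 / b) → u t = 0)
    (hvs : ∀ t, t ∉ Set.Ioc c (c + 1 / b) → v t = 0) :
    HasSum (fun m : ℤ =>
      (starRingEnd ℂ) (∫ t : ℝ,
          (starRingEnd ℂ) (Complex.exp (2 * Real.pi * Complex.I * (m * b * t))) * u t) *
        ∫ t : ℝ, (starRingEnd ℂ) (Complex.exp (2 * Real.pi * Complex.I * (m * b * t))) * v t)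
      ((1 / b : ℂ) * ∫ t : ℝ, (starRingEnd ℂ) (u t) * v t) := by
  have hT : Fact (0 < 1 / b) := ⟨by positivity⟩
  have hab : c < c + 1 / b := lt_add_of_pos_right c hT.out
  have hbC : (b : ℂ) ≠ 0 := by exact_mod_cast hb.ne'
  have hU := (hu.restrict (Set.Ioc c (c + 1 / b))).memLp_liftIoc.haarAddCircle
  have hV := (hv.restrict (Set.Ioc c (c + 1 / b))).memLp_liftIoc.haarAddCircle
  have hint : ∀ w : ℝ → ℂ, (∀ t, t ∉ Set.Ioc c (c + 1 / b) → w t = 0) →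
      ∫ t in c..(c + 1 / b), w t = ∫ t, w t := by
    intro w hw
    rw [intervalIntegral.integral_of_le hab.le]
    exact setIntegral_eq_integral_of_forall_compl_eq_zero hw
  have hcoef : ∀ (w : ℝ → ℂ), (∀ t, t ∉ Set.Ioc c (c + 1 / b) → w t = 0) →
      ∀ (hW : MemLp (AddCircle.liftIoc (1 / b) c w) 2 AddCircle.haarAddCircle) (m : ℤ),
      fourierCoeff hW.toLp m =
        b * ∫ t : ℝ,
          (starRingEnd ℂ) (Complex.exp (2 * Real.pi * Complex.I * (m * b * t))) * w t := by
    intro w hw hW m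
    rw [fourierCoeff_congr_ae hW.coeFn_toLp, fourierCoeff_liftIoc_eq, fourierCoeffOn_eq_integral,
      ← hint _ fun t ht => by rw [hw t ht, mul_zero]]
    have hl : c + 1 / b - c = 1 / b := by ring
    rw [hl, one_div_one_div, Complex.real_smul]
    congr 1
    refine intervalIntegral.integral_congr fun t _ => ?_
    simp only [smul_eq_mul, fourier_coe_apply, ← Complex.exp_conj]
    congr 2
    simp only [map_mul, map_ofNat, Complex.conj_ofReal, Complex.conj_I, map_intCast]
    push_cast
    field_simp
  have h := (fourierBasis (T := 1 / b)).hasSum_inner_mul_inner hU.toLp hV.toLp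
  have hin : (inner ℂ hU.toLp hV.toLp : ℂ) = b * ∫ t : ℝ, (starRingEnd ℂ) (u t) * v t := by
    rw [L2.inner_def, ← hint _ fun t ht => by rw [hvs t ht, mul_zero],
      ← AddCircle.integral_liftIoc_eq_intervalIntegral]
    calc _ = ∫ x, AddCircle.liftIoc (1 / b) c (fun t => (starRingEnd ℂ) (u t) * v t) x
            ∂AddCircle.haarAddCircle := by
          refine integral_congr_ae ?_
          filter_upwards [hU.coeFn_toLp, hV.coeFn_toLp] with x hx hy
          rw [hx, hy, RCLike.inner_apply']
          rfl
      _ = _ := by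
          rw [AddCircle.integral_haarAddCircle, Complex.real_smul]
          simp
  simp only [← HilbertBasis.repr_apply_apply, fourierBasis_repr, hin] at h
  -- Normalised Haar measure puts a factor `b` on each Fourier coefficient and one `b` on the inner
  -- product; dividing by `b²` leaves `1/b`.
  have h2 := h.mul_left ((1 / b : ℂ) ^ 2)
  convert! h2 using 1
  · ext m
    rw [← inner_conj_symm, ← HilbertBasis.repr_apply_apply, fourierBasis_repr, hcoef u hus hU,
      hcoef v hvs hV, map_mul, Complex.conj_ofReal]
    field_simp
  · field_simp

/-! ### Blocks and inner products with the atoms. -/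

/-- The interval `((j - 1) / b, j / b]`. -/
def walnutBlock (b : ℝ) (j : ℤ) : Set ℝ := Set.Ioc ((j - 1) / b) ((j - 1) / b + 1 / b)

theorem mem_walnutBlock {b : ℝ} (hb : 0 < b) {j : ℤ} {t : ℝ} :
    t ∈ walnutBlock b j ↔ ⌈t * b⌉ = j := by
  rw [walnutBlock, Set.mem_Ioc, Int.ceil_eq_iff, ← add_div, sub_add_cancel, div_lt_iff₀ hb,
    le_div_iff₀ hb]

theorem sub_mem_walnutBlock {b : ℝ} (hb : 0 < b) {j k : ℤ} {t : ℝ} :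
    t - k / b ∈ walnutBlock b j ↔ t ∈ walnutBlock b (j + k) := by
  rw [mem_walnutBlock hb, mem_walnutBlock hb, sub_mul, div_mul_cancel₀ _ hb.ne',
    Int.ceil_sub_intCast]
  omega

theorem measurableSet_walnutBlock (b : ℝ) (j : ℤ) : MeasurableSet (walnutBlock b j) :=
  measurableSet_Ioc

theorem inner_whAtom (g : L2R) (a b : ℝ) (m n : ℤ) (f : L2R) :
    (inner ℂ (whAtom g a b m n) f : ℂ) =
      ∫ t : ℝ, (starRingEnd ℂ) (Complex.exp (2 * Real.pi * Complex.I * (m * b * t))) *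
        ((starRingEnd ℂ) (g (t - n * a)) * f t) := by
  rw [L2.inner_def]
  refine integral_congr_ae ?_
  filter_upwards [(memLp_whFun (Lp.memLp g) a b m n).coeFn_toLp] with t ht
  rw [RCLike.inner_apply', whAtom, ht, whFun, map_mul, mul_assoc]

theorem aestronglyMeasurable_comp_sub (g : L2R) (c : ℝ) :
    AEStronglyMeasurable (fun t => g (t - c)) (volume : Measure ℝ) :=
  ((Lp.stronglyMeasurable g).comp_measurable (measurable_id.sub_const c)).aestronglyMeasurable

theorem ae_comp_sub {p : ℝ → Prop} (h : ∀ᵐ t : ℝ, p t) (c : ℝ) : ∀ᵐ t : ℝ, p (t - c) :=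
  (measurePreserving_sub_right volume c).quasiMeasurePreserving.ae h

/-- Parseval's identity on a set contained in an interval of length `1 / b`, applied to an
indicator function. -/
theorem hasSum_norm_inner_whAtom_indicator (g : L2R) (a : ℝ) {b : ℝ} (hb : 0 < b) (n : ℤ)
    {j : ℤ} {s : Set ℝ} (hs : MeasurableSet s) (hμ : volume s ≠ ⊤) (hsj : s ⊆ walnutBlock b j) :
    HasSum (fun m : ℤ =>
      ‖(inner ℂ (whAtom g a b m n) (indicatorConstLp 2 hs hμ (1 : ℂ)) : ℂ)‖ ^ 2)
      (1 / b * ∫ t in s, ‖g (t - n * a)‖ ^ 2) := by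
  set u : ℝ → ℂ := s.indicator fun t => (starRingEnd ℂ) (g (t - n * a)) with hu_def
  have hg : MemLp (fun t => g (t - n * a)) 2 (volume : Measure ℝ) :=
    (Lp.memLp g).comp_measurePreserving (measurePreserving_sub_right volume (n * a))
  have hu : MemLp u 2 volume := hg.star.indicator hs
  have hsupp : ∀ t, t ∉ walnutBlock b j → u t = 0 := fun t ht =>
    Set.indicator_of_notMem (fun h => ht (hsj h)) _
  have h := hasSum_parseval_of_support hb _ hu hu hsupp hsupp
  have hin : ∀ m : ℤ, (inner ℂ (whAtom g a b m n) (indicatorConstLp 2 hs hμ (1 : ℂ)) : ℂ) =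
      ∫ t : ℝ, (starRingEnd ℂ) (Complex.exp (2 * Real.pi * Complex.I * (m * b * t))) * u t := by
    intro m
    rw [inner_whAtom]
    refine integral_congr_ae ?_
    filter_upwards [indicatorConstLp_coeFn (p := 2) (hs := hs) (hμs := hμ) (c := (1 : ℂ))]
      with t ht
    rw [ht, hu_def]
    by_cases hts : t ∈ s <;> simp [hts]
  simp only [← hin, Complex.conj_mul'] at h
  rw [← Complex.hasSum_ofReal]
  push_cast
  convert h using 2
  rw [← integral_indicator hs, ← integral_complex_ofReal]
  refine integral_congr_ae (Eventually.of_forall fun t => ?_)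
  by_cases hts : t ∈ s <;> simp [hu_def, hts]

/-! ### Bounded periodisation and the functions `G_k`. -/

/-- The periodisation of `|g|²` is bounded by `C`. -/
def HasBoundedPeriodization (g : L2R) (a C : ℝ) : Prop :=
  ∀ᵐ t : ℝ, Summable (fun n : ℤ => ‖g (t - n * a)‖ ^ 2) ∧ ∑' n : ℤ, ‖g (t - n * a)‖ ^ 2 ≤ C

/-- Test the Bessel bound on indicators of subsets `E` of a block: Parseval gives `(1/b) ∫_E ∑ₙ |g(t
- na)|² ≤ B |E|` for all such `E`, hence the pointwise bound `bB`. -/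
theorem IsPreframe.hasBoundedPeriodization {g : L2R} {a b : ℝ} (hb : 0 < b)
    (hg : IsPreframe g a b) : ∃ C, HasBoundedPeriodization g a C := by
  obtain ⟨B, hB, hg⟩ := hg
  refine ⟨b * B, ?_⟩
  have hm : ∀ n : ℤ, Measurable fun t : ℝ => ‖g (t - n * a)‖ₑ ^ 2 := fun n =>
    ((Lp.stronglyMeasurable g).comp_measurable
      (measurable_id.sub_const (n * a))).measurable.enorm.pow_const 2
  have hblock : ∀ j : ℤ, ∀ᵐ t : ℝ, t ∈ walnutBlock b j →
      ∑' n : ℤ, ‖g (t - n * a)‖ₑ ^ 2 ≤ ENNReal.ofReal (b * B) := by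
    intro j
    rw [← ae_restrict_iff' (measurableSet_walnutBlock b j)]
    refine ae_le_of_forall_setLIntegral_le_of_sigmaFinite (Measurable.tsum hm)
      fun s hs _ => ?_
    rw [Measure.restrict_restrict hs]
    set E := s ∩ walnutBlock b j
    have hEm : MeasurableSet E := hs.inter (measurableSet_walnutBlock b j)
    have hEf : volume E ≠ ⊤ :=
      ((measure_mono Set.inter_subset_right).trans_lt measure_Ioc_lt_top).ne
    obtain ⟨hsum, hle⟩ := hg (indicatorConstLp 2 hEm hEf 1)
    have h1 := ((Equiv.prodComm ℤ ℤ).hasSum_iff.2 hsum.hasSum).prod_fiberwise fun n =>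
      hasSum_norm_inner_whAtom_indicator g a hb n hEm hEf Set.inter_subset_right
    have hnorm : ‖(indicatorConstLp 2 hEm hEf 1 : L2R)‖ ^ 2 = volume.real E := by
      rw [norm_indicatorConstLp (by simp) (by simp), norm_one, one_mul, ← Real.rpow_natCast,
        ← Real.rpow_mul measureReal_nonneg]
      norm_num
    rw [hnorm] at hle
    have h2 := h1.mul_left b
    have hint : ∀ n : ℤ, ∫⁻ t in E, ‖g (t - n * a)‖ₑ ^ 2 =
        ENNReal.ofReal (b * (1 / b * ∫ t in E, ‖g (t - n * a)‖ ^ 2)) := by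
      intro n
      have hgn : MemLp (fun t => g (t - n * a)) 2 (volume : Measure ℝ) :=
        (Lp.memLp g).comp_measurePreserving (measurePreserving_sub_right volume (n * a))
      rw [← mul_assoc, mul_one_div_cancel hb.ne', one_mul,
        ofReal_integral_eq_lintegral_ofReal (hgn.integrable_norm_pow (by simp)).restrict
          (Eventually.of_forall fun t => by positivity)]
      simp [ENNReal.ofReal_pow]
    rw [lintegral_tsum fun n => (hm n).aemeasurable, setLIntegral_const]
    simp only [hint]
    rw [← ENNReal.ofReal_tsum_of_nonneg (fun n => by positivity) h2.summable, h2.tsum_eq,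
      ← ofReal_measureReal hEf, ← ENNReal.ofReal_mul (by positivity)]
    refine ENNReal.ofReal_le_ofReal ?_
    rw [mul_assoc]
    gcongr
  filter_upwards [ae_all_iff.2 hblock] with t ht
  have h1 := ht _ ((mem_walnutBlock hb).2 rfl)
  have hs : Summable (fun n : ℤ => ‖g (t - n * a)‖ ^ 2) := by
    have h2 : (∑' n : ℤ, ((‖g (t - n * a)‖₊ ^ 2 : NNReal) : ENNReal)) ≠ ⊤ := by
      refine (lt_of_le_of_lt (le_of_eq ?_) (h1.trans_lt ENNReal.ofReal_lt_top)).ne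
      simp [enorm]
    simpa using NNReal.summable_coe.2 (ENNReal.tsum_coe_ne_top_iff_summable.1 h2)
  refine ⟨hs, (ENNReal.ofReal_le_ofReal_iff (by positivity)).1 ?_⟩
  rw [ENNReal.ofReal_tsum_of_nonneg (fun n => by positivity) hs]
  simpa [ENNReal.ofReal_pow] using h1

section Periodization

variable {g : L2R} {a C : ℝ}

/-- By AM–GM the series is dominated by the mean of the periodisations at `t` and `t - k/b`, each at
most `C`. -/
theorem HasBoundedPeriodization.summable_norm_walnutTerm (hg : HasBoundedPeriodization g a C)
    (b : ℝ) (k : ℤ) : ∀ᵐ t : ℝ, Summable (fun n => ‖walnutTerm g a b k t n‖) ∧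
      ∑' n, ‖walnutTerm g a b k t n‖ ≤ C := by
  filter_upwards [hg, ae_comp_sub hg (k / b)] with t ⟨h1, h1'⟩ ⟨h2, h2'⟩
  simp only [sub_right_comm t (k / b : ℝ)] at h2 h2'
  have h3 := (h1.hasSum.add h2.hasSum).mul_left (1 / 2)
  have hle : ∀ n, ‖walnutTerm g a b k t n‖ ≤
      1 / 2 * (‖g (t - n * a)‖ ^ 2 + ‖g (t - n * a - k / b)‖ ^ 2) := by
    intro n
    rw [walnutTerm, norm_mul, RCLike.norm_conj]
    nlinarith [sq_nonneg (‖g (t - n * a)‖ - ‖g (t - n * a - k / b)‖)]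
  have hs := Summable.of_nonneg_of_le (fun n => norm_nonneg _) hle h3.summable
  refine ⟨hs, (hs.tsum_le_tsum hle h3.summable).trans ?_⟩
  rw [h3.tsum_eq]
  linarith

theorem HasBoundedPeriodization.norm_le (hg : HasBoundedPeriodization g a C) :
    ∀ᵐ t : ℝ, ‖g t‖ ≤ √C := by
  filter_upwards [hg] with t ⟨h1, h2⟩
  have h3 := h1.le_tsum 0 fun n _ => by positivity
  refine Real.le_sqrt_of_sq_le ?_
  simpa using h3.trans h2

theorem HasBoundedPeriodization.norm_walnutG_le (hg : HasBoundedPeriodization g a C) (b : ℝ)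
    (k : ℤ) : ∀ᵐ t : ℝ, ‖walnutG g a b k t‖ ≤ C := by
  filter_upwards [hg.summable_norm_walnutTerm b k] with t ⟨h1, h2⟩
  exact (norm_tsum_le_tsum_norm h1).trans h2

theorem stronglyMeasurable_walnutTerm (g : L2R) (a b : ℝ) (k n : ℤ) :
    StronglyMeasurable fun t => walnutTerm g a b k t n := by
  have h : ∀ φ : ℝ → ℝ, Measurable φ → StronglyMeasurable fun t => g (φ t) := fun φ hφ =>
    (Lp.stronglyMeasurable g).comp_measurable hφ
  exact (h _ (by fun_prop)).mul (RCLike.continuous_conj.comp_stronglyMeasurable (h _ (by fun_prop)))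

theorem stronglyMeasurable_walnutG (g : L2R) (a b : ℝ) (k : ℤ) :
    StronglyMeasurable (walnutG g a b k) :=
  StronglyMeasurable.tsum fun n => stronglyMeasurable_walnutTerm g a b k n

theorem HasBoundedPeriodization.memLp_walnutG (hg : HasBoundedPeriodization g a C) (b : ℝ)
    (k : ℤ) : MemLp (walnutG g a b k) ⊤ volume :=
  memLp_top_of_bound (stronglyMeasurable_walnutG g a b k).aestronglyMeasurable C
    (hg.norm_walnutG_le b k)

end Periodization

/-! ### Diagonal operators and block projections. -/

/-- Multiplication by a bounded function, as an operator on `L²(ℝ)`. -/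
noncomputable def mulCLM {u : ℝ → ℂ} (hu : MemLp u ⊤ volume) : L2R →L[ℂ] L2R :=
  (ContinuousLinearMap.mul ℂ ℂ).holderL volume ⊤ 2 2 hu.toLp

theorem coeFn_mulCLM {u : ℝ → ℂ} (hu : MemLp u ⊤ volume) (f : L2R) :
    ∀ᵐ t : ℝ, mulCLM hu f t = u t * f t := by
  filter_upwards [(ContinuousLinearMap.mul ℂ ℂ).coeFn_holder (r := 2) hu.toLp f, hu.coeFn_toLp]
    with t h1 h2
  rw [← h2]
  exact h1

/-- Translation by `c`, as an operator on `L²(ℝ)`. -/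
noncomputable def translationCLM (c : ℝ) : L2R →L[ℂ] L2R :=
  (Lp.compMeasurePreservingₗᵢ ℂ (fun t : ℝ => t - c)
    (measurePreserving_sub_right volume c)).toContinuousLinearMap

theorem coeFn_translationCLM (c : ℝ) (f : L2R) : ∀ᵐ t : ℝ, translationCLM c f t = f (t - c) :=
  Lp.coeFn_compMeasurePreserving f (measurePreserving_sub_right volume c)

/-- The `k`-th diagonal `f ↦ (1/b) f(· - k/b) G_k` of the Walnut representation. -/
noncomputable def walnutDiag (g : L2R) (a b : ℝ) {C : ℝ} (hg : HasBoundedPeriodization g a C)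
    (k : ℤ) : L2R →L[ℂ] L2R :=
  (1 / b : ℂ) • (mulCLM (hg.memLp_walnutG b k)).comp (translationCLM (k / b))

theorem coeFn_walnutDiag (g : L2R) (a b : ℝ) {C : ℝ} (hg : HasBoundedPeriodization g a C) (k : ℤ)
    (f : L2R) :
    ∀ᵐ t : ℝ, walnutDiag g a b hg k f t = (1 / b : ℂ) * (f (t - k / b) * walnutG g a b k t) := by
  filter_upwards [Lp.coeFn_smul (1 / b : ℂ)
      (mulCLM (hg.memLp_walnutG b k) (translationCLM (k / b) f)),
    coeFn_mulCLM (hg.memLp_walnutG b k) (translationCLM (k / b) f),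
    coeFn_translationCLM (k / b) f] with t h1 h2 h3
  rw [mul_comm (f _), ← h3, ← h2]
  exact h1

theorem isWalnutPartialSum_sum_walnutDiag (g : L2R) (a b : ℝ) {C : ℝ}
    (hg : HasBoundedPeriodization g a C) (K L : ℤ) :
    IsWalnutPartialSum g a b K L (∑ k ∈ Finset.Icc (-L) K, walnutDiag g a b hg k) := by
  intro f
  rw [_root_.sum_apply]
  filter_upwards [Lp.coeFn_finsetSum (Finset.Icc (-L) K) fun k => walnutDiag g a b hg k f,
    ae_all_iff.2 fun k => coeFn_walnutDiag g a b hg k f] with t h1 h2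
  rw [h1, Finset.mul_sum]
  simp [h2]

/-- Restriction to the `j`-th block, as an operator on `L²(ℝ)`. -/
noncomputable def blockProj (b : ℝ) (j : ℤ) : L2R →L[ℂ] L2R :=
  mulCLM ((memLp_top_const (1 : ℂ)).indicator (measurableSet_walnutBlock b j))

theorem coeFn_blockProj (b : ℝ) (j : ℤ) (f : L2R) :
    ∀ᵐ t : ℝ, blockProj b j f t = (walnutBlock b j).indicator f t := by
  filter_upwards [coeFn_mulCLM ((memLp_top_const (1 : ℂ)).indicator
    (measurableSet_walnutBlock b j)) f] with t ht
  rw [blockProj, ht]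
  by_cases h : t ∈ walnutBlock b j <;> simp [h]

theorem inner_blockProj (b : ℝ) (j : ℤ) (f h : L2R) :
    (inner ℂ (blockProj b j h) f : ℂ) = inner ℂ h (blockProj b j f) := by
  rw [L2.inner_def, L2.inner_def]
  refine integral_congr_ae ?_
  filter_upwards [coeFn_blockProj b j f, coeFn_blockProj b j h] with t h1 h2
  rw [h1, h2]
  by_cases ht : t ∈ walnutBlock b j <;> simp [ht]

theorem hasSum_blockProj {b : ℝ} (hb : 0 < b) (f : L2R) :
    HasSum (fun j => blockProj b j f) f := by
  have hnorm : ∀ h : L2R, ‖h‖ ^ 2 = ∫ t, ‖h t‖ ^ 2 := by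
    intro h
    have h1 := @inner_self_eq_norm_sq_to_K ℂ L2R _ _ _ h
    rw [L2.inner_def] at h1
    have h2 : ∀ t, (inner ℂ (h t) (h t) : ℂ) = ((‖h t‖ ^ 2 : ℝ) : ℂ) := fun t => by
      rw [inner_self_eq_norm_sq_to_K]; push_cast; rfl
    simp only [h2] at h1
    rw [integral_complex_ofReal] at h1
    refine Complex.ofReal_injective (h1.trans ?_).symm
    push_cast
    rfl
  have hf : Integrable (fun t => ‖f t‖ ^ 2) (volume : Measure ℝ) :=
    (Lp.memLp f).integrable_norm_pow (by simp)
  have hae : ∀ s : Finset ℤ, ∀ᵐ t : ℝ, (∑ j ∈ s, blockProj b j f - f : L2R) t =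
      if ⌈t * b⌉ ∈ s then 0 else - f t := by
    intro s
    filter_upwards [Lp.coeFn_sub (∑ j ∈ s, blockProj b j f) f,
      Lp.coeFn_fun_finsetSum s fun j => blockProj b j f,
      ae_all_iff.2 fun j => coeFn_blockProj b j f] with t h1 h2 h3
    rw [h1, Pi.sub_apply, h2]
    have h4 : ∀ j, (walnutBlock b j).indicator f t = if ⌈t * b⌉ = j then f t else 0 := by
      intro j
      by_cases h : t ∈ walnutBlock b j
      · rw [Set.indicator_of_mem h, if_pos ((mem_walnutBlock hb).1 h)]
      · rw [Set.indicator_of_notMem h, if_neg fun h' => h ((mem_walnutBlock hb).2 h')]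
    simp only [h3, h4, Finset.sum_ite_eq]
    split_ifs <;> simp
  -- Dominated convergence: at each `t` the error is `0` once the finite set contains `⌈t * b⌉`, and
  -- it never exceeds `|f t|`.
  have key : Tendsto (fun s : Finset ℤ => ∫ t, ‖(∑ j ∈ s, blockProj b j f - f : L2R) t‖ ^ 2) atTop
      (𝓝 (∫ _ : ℝ, (0 : ℝ))) := by
    refine tendsto_integral_filter_of_dominated_convergence (fun t => ‖f t‖ ^ 2)
      (Eventually.of_forall fun s => ((Lp.aestronglyMeasurable _).norm.pow 2))
      (Eventually.of_forall fun s => ?_) hf ?_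
    · filter_upwards [hae s] with t ht
      rw [ht]
      split_ifs <;> simp
    · filter_upwards [ae_all_iff.2 hae] with t ht
      refine tendsto_const_nhds.congr' ?_
      filter_upwards [eventually_ge_atTop {⌈t * b⌉}] with s hs
      rw [ht, if_pos (hs (Finset.mem_singleton_self _))]
      simp
  simp only [← hnorm, integral_zero] at key
  rw [HasSum, tendsto_iff_norm_sub_tendsto_zero]
  have h := (Real.continuous_sqrt.tendsto 0).comp key
  simpa [Function.comp_def, Real.sqrt_sq] using h

/-! ### The block matrix of the frame operator. -/

section FrameOperator

variable {g : L2R} {a b C : ℝ} {S : L2R →L[ℂ] L2R}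

/-- Translation by `k/b` leaves the exponential unchanged, as `mb · k/b` is an integer, and moves
block `j` onto block `j + k`, so that both factors in Parseval can live on one interval. -/
theorem inner_whAtom_blockProj (g : L2R) (a : ℝ) {b : ℝ} (hb : 0 < b) (m n j k : ℤ) (f : L2R) :
    (inner ℂ (whAtom g a b m n) (blockProj b j f) : ℂ) =
      ∫ t : ℝ, (starRingEnd ℂ) (Complex.exp (2 * Real.pi * Complex.I * (m * b * t))) *
        ((starRingEnd ℂ) (g (t - n * a - k / b)) * (walnutBlock b j).indicator f (t - k / b)) := by
  rw [inner_whAtom, ← integral_sub_right_eq_self _ (k / b : ℝ)]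
  refine integral_congr_ae ?_
  filter_upwards [ae_comp_sub (coeFn_blockProj b j f) (k / b)] with t ht
  have hbC : (b : ℂ) ≠ 0 := by exact_mod_cast hb.ne'
  have he : Complex.exp (2 * Real.pi * Complex.I * (m * b * (t - k / b : ℝ))) =
      Complex.exp (2 * Real.pi * Complex.I * (m * b * t)) := by
    rw [show 2 * Real.pi * Complex.I * (m * b * (t - k / b : ℝ)) =
      2 * Real.pi * Complex.I * (m * b * t) - (m * k : ℤ) * (2 * Real.pi * Complex.I) by
        push_cast; field_simp, Complex.exp_sub, Complex.exp_int_mul_two_pi_mul_I, div_one]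
  rw [ht, he, sub_right_comm]

theorem HasBoundedPeriodization.hasSum_integral_walnutTerm (hg : HasBoundedPeriodization g a C)
    (b : ℝ) (k : ℤ) {u v : ℝ → ℂ} (hu : MemLp u 2 volume) (hv : MemLp v 2 volume) :
    HasSum (fun n : ℤ => ∫ t : ℝ, (starRingEnd ℂ) (u t) * v t * walnutTerm g a b k t n)
      (∫ t : ℝ, (starRingEnd ℂ) (u t) * v t * walnutG g a b k t) := by
  have huv : Integrable (fun t => (starRingEnd ℂ) (u t) * v t) volume :=
    hu.star.integrable_mul hv
  refine hasSum_integral_of_dominated_convergence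
    (fun n t => ‖(starRingEnd ℂ) (u t) * v t‖ * ‖walnutTerm g a b k t n‖)
    (fun n => huv.aestronglyMeasurable.mul
      (stronglyMeasurable_walnutTerm g a b k n).aestronglyMeasurable)
    (fun n => Eventually.of_forall fun t => (norm_mul _ _).le) ?_ ?_ ?_
  · filter_upwards [hg.summable_norm_walnutTerm b k] with t ht
    exact ht.1.mul_left _
  · refine (huv.norm.const_mul C).mono' (AEStronglyMeasurable.tsum fun n =>
      huv.aestronglyMeasurable.norm.mul
        (stronglyMeasurable_walnutTerm g a b k n).aestronglyMeasurable.norm) ?_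
    filter_upwards [hg.summable_norm_walnutTerm b k] with t ht
    have h0 : 0 ≤ ∑' n, ‖walnutTerm g a b k t n‖ := tsum_nonneg fun n => norm_nonneg _
    rw [tsum_mul_left, Real.norm_of_nonneg (by positivity), mul_comm C]
    exact mul_le_mul_of_nonneg_left ht.2 (norm_nonneg _)
  · filter_upwards [hg.summable_norm_walnutTerm b k] with t ht
    exact ht.1.of_norm.hasSum.mul_left _

theorem inner_frameOperator_blockProj (hb : 0 < b) (hg : HasBoundedPeriodization g a C)
    (hS : IsFrameOperator g a b S) (j k : ℤ) (f h : L2R) :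
    (inner ℂ (blockProj b (j + k) h) (S (blockProj b j f)) : ℂ) =
      (1 / b : ℂ) * ∫ t : ℝ, (starRingEnd ℂ) ((walnutBlock b (j + k)).indicator h t) *
        (walnutBlock b j).indicator f (t - k / b) * walnutG g a b k t := by
  set u : ℝ → ℂ := (walnutBlock b (j + k)).indicator h
  set v : ℝ → ℂ := fun t => (walnutBlock b j).indicator f (t - k / b)
  have hu : MemLp u 2 volume := (Lp.memLp h).indicator (measurableSet_walnutBlock b _)
  have hv : MemLp v 2 volume :=
    ((Lp.memLp f).indicator (measurableSet_walnutBlock b j)).comp_measurePreserving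
      (measurePreserving_sub_right volume (k / b : ℝ))
  have hus : ∀ t, t ∉ walnutBlock b (j + k) → u t = 0 := fun t ht =>
    Set.indicator_of_notMem ht _
  have hvs : ∀ t, t ∉ walnutBlock b (j + k) → v t = 0 := fun t ht =>
    Set.indicator_of_notMem (fun h' => ht ((sub_mem_walnutBlock hb).1 h')) _
  -- Since `|g| ≤ √C` almost everywhere, these products stay in `L²`, as Parseval needs.
  have hmul : ∀ (c : ℝ) (w : ℝ → ℂ), MemLp w 2 volume →
      MemLp (fun t => (starRingEnd ℂ) (g (t - c)) * w t) 2 volume := by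
    intro c w hw
    refine hw.of_le_mul (c := √C) ((RCLike.continuous_conj.comp_aestronglyMeasurable
      (aestronglyMeasurable_comp_sub g c)).mul hw.1) ?_
    filter_upwards [ae_comp_sub hg.norm_le c] with t ht
    rw [norm_mul, RCLike.norm_conj]
    gcongr
  have hfiber : ∀ n : ℤ, HasSum (fun m : ℤ =>
      (inner ℂ (whAtom g a b m n) (blockProj b j f) : ℂ) *
        inner ℂ (blockProj b (j + k) h) (whAtom g a b m n))
      ((1 / b : ℂ) * ∫ t : ℝ, (starRingEnd ℂ) (u t) * v t * walnutTerm g a b k t n) := by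
    intro n
    have h1 := hasSum_parseval_of_support hb _ (hmul (n * a) u hu)
      (by simpa only [← sub_sub] using hmul (n * a + k / b) v hv)
      (fun t ht => by rw [hus t ht, mul_zero]) (fun t ht => by rw [hvs t ht, mul_zero])
    convert! h1 using 1
    · ext m
      have h0 := inner_whAtom_blockProj g a hb m n (j + k) 0 h
      simp only [Int.cast_zero, zero_div, sub_zero] at h0
      rw [← inner_conj_symm (blockProj b (j + k) h), h0, inner_whAtom_blockProj g a hb m n j k f,
        mul_comm]
    · congr 2
      ext t
      simp only [walnutTerm, map_mul, Complex.conj_conj]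
      ring
  have h1 := (hS (blockProj b j f)).mapL (innerSL ℂ (blockProj b (j + k) h))
  simp only [innerSL_apply_apply, inner_smul_right] at h1
  -- Summing over `m` first, then `n`, must give the same value as the double series for `S`.
  exact (((Equiv.prodComm ℤ ℤ).hasSum_iff.2 h1).prod_fiberwise hfiber).unique
    ((hg.hasSum_integral_walnutTerm b k hu hv).mul_left _)

theorem inner_walnutDiag (b : ℝ) (hg : HasBoundedPeriodization g a C) (k : ℤ) (f h : L2R) :
    (inner ℂ h (walnutDiag g a b hg k f) : ℂ) =
      (1 / b : ℂ) * ∫ t : ℝ, (starRingEnd ℂ) (h t) * f (t - k / b) * walnutG g a b k t := by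
  rw [L2.inner_def, ← integral_const_mul]
  refine integral_congr_ae ?_
  filter_upwards [coeFn_walnutDiag g a b hg k f] with t ht
  rw [ht, RCLike.inner_apply']
  ring

theorem blockProj_frameOperator_blockProj (hb : 0 < b) (hg : HasBoundedPeriodization g a C)
    (hS : IsFrameOperator g a b S) (j k : ℤ) (f : L2R) :
    blockProj b (j + k) (S (blockProj b j f)) = walnutDiag g a b hg k (blockProj b j f) := by
  refine ext_inner_left ℂ fun h => ?_
  rw [← inner_blockProj, inner_frameOperator_blockProj hb hg hS, inner_walnutDiag]
  congr 1
  refine integral_congr_ae ?_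
  filter_upwards [ae_comp_sub (coeFn_blockProj b j f) (k / b)] with t ht
  rw [ht]
  -- The cutoff on `h` is redundant: off block `j + k` the translate of `f` already vanishes.
  by_cases h1 : t ∈ walnutBlock b (j + k)
  · rw [Set.indicator_of_mem h1]
  · rw [Set.indicator_of_notMem (s := walnutBlock b j)
      (fun h' => h1 ((sub_mem_walnutBlock hb).1 h'))]
    simp

theorem IsFrameOperator.inner_self (hS : IsFrameOperator g a b S) (f : L2R) :
    (inner ℂ f (S f) : ℂ) =
      ((∑' q : ℤ × ℤ, ‖(inner ℂ (whAtom g a b q.1 q.2) f : ℂ)‖ ^ 2 : ℝ) : ℂ) := by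
  have h1 := (hS f).mapL (innerSL ℂ f)
  simp only [innerSL_apply_apply, inner_smul_right] at h1
  rw [← h1.tsum_eq, Complex.ofReal_tsum]
  congr 1
  ext q
  rw [← inner_conj_symm f, Complex.mul_conj', Complex.ofReal_pow]

end FrameOperator

/-! ### Bessel families and polarisation. -/

/-- A Bessel family in a Hilbert space has a frame operator. -/
theorem exists_frameOperator_of_bessel {E ι : Type*} [NormedAddCommGroup E] [InnerProductSpace ℂ E]
    [CompleteSpace E] (e : ι → E) {B : ℝ} (hB : 0 ≤ B)
    (h : ∀ f : E, Summable (fun i => ‖(inner ℂ (e i) f : ℂ)‖ ^ 2) ∧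
      ∑' i, ‖(inner ℂ (e i) f : ℂ)‖ ^ 2 ≤ B * ‖f‖ ^ 2) :
    ∃ S : E →L[ℂ] E, ∀ f, HasSum (fun i => (inner ℂ (e i) f : ℂ) • e i) (S f) := by
  classical
  let A₀ : E →ₗ[ℂ] lp (fun _ : ι => ℂ) 2 :=
    { toFun := fun f => ⟨fun i => inner ℂ (e i) f,
        memℓp_gen (by simpa using (h f).1)⟩
      map_add' := fun f f' => by ext i; exact inner_add_right _ _ _
      map_smul' := fun c f => by ext i; exact inner_smul_right _ _ _ }
  have hA₀ : ∀ f i, A₀ f i = inner ℂ (e i) f := fun _ _ => rfl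
  let A : E →L[ℂ] lp (fun _ : ι => ℂ) 2 := A₀.mkContinuous √B fun f => by
    refine le_of_sq_le_sq ?_ (by positivity)
    rw [mul_pow, Real.sq_sqrt hB]
    have h1 := lp.norm_rpow_eq_tsum (p := 2) (by simp) (A₀ f)
    simp only [ENNReal.toReal_ofNat, Real.rpow_two] at h1
    rw [h1]
    exact (h f).2
  -- `A` is the analysis operator into `ℓ²`; its adjoint sends the unit vectors to the `e i`, so
  -- expanding `A f` coordinatewise gives the series.
  refine ⟨A.adjoint.comp A, fun f => ?_⟩
  have h2 := (lp.hasSum_single (p := 2) (by simp) (A f)).mapL A.adjoint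
  convert! h2 using 1
  ext i
  refine ext_inner_left ℂ fun x => ?_
  rw [ContinuousLinearMap.adjoint_inner_right, lp.inner_single_right, inner_smul_right]
  change _ * _ = inner ℂ (inner ℂ (e i) x : ℂ) (inner ℂ (e i) f : ℂ)
  rw [RCLike.inner_apply, inner_conj_symm]

/-- Convergence of all quadratic forms implies weak operator convergence. -/
theorem tendsto_inner_of_tendsto_inner_self {E ι : Type*} [NormedAddCommGroup E]
    [InnerProductSpace ℂ E] {l : Filter ι} (T : ι → E →L[ℂ] E) (S : E →L[ℂ] E)
    (h : ∀ f, Tendsto (fun i => (inner ℂ f (T i f) : ℂ)) l (𝓝 (inner ℂ f (S f)))) (φ f : E) :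
    Tendsto (fun i => (inner ℂ φ (T i f) : ℂ)) l (𝓝 (inner ℂ φ (S f))) := by
  have hpol : ∀ R : E →L[ℂ] E, (inner ℂ φ (R f) : ℂ) =
      (inner ℂ (φ + f) (R (φ + f)) - inner ℂ (φ - f) (R (φ - f)) -
        Complex.I * inner ℂ (φ + Complex.I • f) (R (φ + Complex.I • f)) +
        Complex.I * inner ℂ (φ - Complex.I • f) (R (φ - Complex.I • f))) / 4 := by
    intro R
    simp only [map_add, map_sub, map_smul, inner_add_left, inner_add_right, inner_sub_left,
      inner_sub_right, inner_smul_left, inner_smul_right, Complex.conj_I]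
    linear_combination ((inner ℂ φ (R f) : ℂ) / 2 - (inner ℂ f (R φ) : ℂ) / 2) * Complex.I_sq
  simp only [hpol]
  exact ((((h _).sub (h _)).sub ((h _).const_mul _)).add ((h _).const_mul _)).div_const _

/-! ### The equivalences. -/

theorem mainTheorem5 (a b : ℝ) (hb : 0 < b) (g : L2R) (hg : IsPreframe g a b) :
    (∀ k : ℤ, ∀ᵐ t : ℝ, Summable (walnutTerm g a b k t)) ∧
    ∃ (S : L2R →L[ℂ] L2R) (SKL : ℤ → ℤ → L2R →L[ℂ] L2R),
      IsFrameOperator g a b S ∧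
      (∀ K L : ℤ, IsWalnutPartialSum g a b K L (SKL K L)) ∧
      List.TFAE [
        -- the Walnut series converges in norm for every `f`
        ∀ f : L2R, ∃ h : L2R, Tendsto (fun p : ℤ × ℤ => SKL p.1 p.2 f) atTop (𝓝 h),
        -- the Walnut series converges weakly for every `f`
        ∀ f : L2R, ∃ h : L2R, ∀ φ : L2R,
          Tendsto (fun p : ℤ × ℤ => (inner ℂ φ (SKL p.1 p.2 f) : ℂ)) atTop (𝓝 (inner ℂ φ h)),
        -- the operators `S_{K,L}` are uniformly bounded in operator norm
        BddAbove (Set.range fun p : ℤ × ℤ => ‖SKL p.1 p.2‖),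
        -- `⟨S_{K,L} f, f⟩` tends to `⟨S f, f⟩` for every `f`
        ∀ f : L2R,
          Tendsto (fun p : ℤ × ℤ => (inner ℂ f (SKL p.1 p.2 f) : ℂ)) atTop (𝓝 (inner ℂ f (S f))),
        -- the WH-frame identity holds for every `f`, its right side being the double-sided limit
        ∀ f : L2R,
          Tendsto
            (fun p : ℤ × ℤ => (1 / b : ℂ) * ∑ k ∈ Finset.Icc (-p.2) p.1,
              ∫ t : ℝ, (starRingEnd ℂ) (f t) * f (t - k / b) * walnutG g a b k t)
            atTop
            (𝓝 ((∑' q : ℤ × ℤ, ‖inner ℂ (whAtom g a b q.1 q.2) f‖ ^ 2 : ℝ) : ℂ))] := by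

  obtain ⟨C, hC⟩ := hg.hasBoundedPeriodization hb
  obtain ⟨S, hS⟩ : ∃ S, IsFrameOperator g a b S := by
    obtain ⟨B, hB, h⟩ := hg
    exact exists_frameOperator_of_bessel (fun p : ℤ × ℤ => whAtom g a b p.1 p.2) hB.le h
  refine ⟨fun k => (hC.summable_norm_walnutTerm b k).mono fun t ht => ht.1.of_norm, S,
    fun K L => ∑ k ∈ Finset.Icc (-L) K, walnutDiag g a b hC k, hS,
    isWalnutPartialSum_sum_walnutDiag g a b hC, ?_⟩
  have hlim := tendsto_sum_diagonals (blockProj b) (walnutDiag g a b hC) S (hasSum_blockProj hb)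
    (blockProj_frameOperator_blockProj hb hC hS)
  tfae_have 1 → 2 := fun h f => by
    obtain ⟨l, hl⟩ := h f
    exact ⟨l, fun φ => Tendsto.inner tendsto_const_nhds hl⟩
  tfae_have 2 → 3 := bddAbove_norm_sum_Icc_of_weak_tendsto _
  tfae_have 3 → 1 := fun h f => ⟨S f, hlim h f⟩
  tfae_have 3 → 4 := fun h f => Tendsto.inner tendsto_const_nhds (hlim h f)
  tfae_have 4 → 2 := fun h f => ⟨S f, fun φ => tendsto_inner_of_tendsto_inner_self _ S h φ f⟩
  tfae_have 4 ↔ 5 := by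
    refine forall_congr' fun f => ?_
    rw [hS.inner_self f]
    simp only [_root_.sum_apply, inner_sum, inner_walnutDiag, Finset.mul_sum]
  tfae_finish
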